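/- Setting. Let $\ell(p,y)=-y\log p-(1-y)\log(1-p)$ be the log loss on $[0,1]\times\{0,1\}$ (with values in $[0,\infty]$) and $\mathsf{KL}(q,p)=q\log\frac qp+(1-q)\log\frac{1-q}{1-p}$. For $K\ge 1$ let $$z_0=\sin^2\tfrac{\pi}{4K},\qquad z_i=\sin^2\tfrac{\pi i}{2K}\ (1\le i\le K-1),\qquad z_K=\cos^2\tfrac{\pi}{4K},\qquad \mathcal Z=\{z_0,\dots,z_K\}.$$ Rounding. For $p\in[0,1]$ let $\mathrm{RROUND}(p)$ be the following probability vector $q$ on $\{0,\dots,K\}$: if $p<z_0$ then $q=e_0$; if $p\ge z_K$ then $q=e_K$; if $p\in[z_i,z_{i+1})$ with $0\le i\le K-1$, then $$q_i=\frac1D\cdot\frac{z_{i+1}-p}{z_{i+1}(1-z_{i+1})},\qquad q_{i+1}=\frac1D\cdot\frac{p-z_i}{z_i(1-z_i)},\qquad q_j=0\ \text{otherwise},$$ where $D$ normalizes $q_i+q_{i+1}=1$. Algorithm. In round $t=1,2,\dots$ the algorithm plays a probability vector $p_t=(p_{t,0},\dots,p_{t,K})$ (that is, $\mathcal P_t(z)=\sum_{i:z_i=z}p_{t,i}$)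 and then sees $y_t\in\{0,1\}$. For $i=0,\dots,K$ let $f_{t,i}(w)=p_{t,i}\,\ell(w,y_t)$ and $$w_{t,i}=\frac{\int_0^1 w\exp\bigl(-\sum_{\tau<t}f_{\tau,i}(w)\bigr)\,dw}{\int_0^1 \exp\bigl(-\sum_{\tau<t}f_{\tau,i}(w)\bigr)\,dw}.$$ Let $Q_t$ be the column-stochastic matrix with columns $q_{t,0},\dots,q_{t,K}$, where $q_{t,i}=\mathrm{RROUND}(w_{t,i})$ for $t\ge2$, and $q_{1,0},\dots,q_{1,K}$ are arbitrary fixed probability vectors (for example uniform, or $\mathrm{RROUND}(1/2)$). The vector $p_t$, which may depend only on $y_1,\dots,y_{t-1}$, is any stationary distribution of $Q_t$: $Q_tp_t=p_t$. Theorem. For every $K\ge1$ and every choice of $q_{1,0},\dots,q_{1,K}$ such an algorithm exists. There is an absolute constant $C>0$ such that for every horizon $T\ge2$, every integer $K$ with $|K-(T/\log T)^{1/3}|<1$ (i.e. $(T/\log T)^{1/3}$ rounded down or up), every choice of $q_{1,0},\dots,q_{1,K}$ and of the stationary distributions, and every outcome sequence $y_1,\dots,y_T\in\{0,1\}$, the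 algorithm satisfies $$\mathsf{PKLCal}=\sum_{p\in\mathcal Z}\sum_{t=1}^T\mathcal P_t(p)\,\mathsf{KL}(\tilde\rho_p,p)\ \le\ C\,T^{1/3}(\log T)^{2/3},\qquad \tilde\rho_p=\frac{\sum_{t=1}^Ty_t\mathcal P_t(p)}{\sum_{t=1}^T\mathcal P_t(p)}\quad\Bigl(\tfrac00=0\Bigr),$$ and the pseudo swap regret of the log loss satisfies the same bound: $$\mathsf{PSReg}^{\ell}=\sup_{\sigma:[0,1]\to[0,1]}\ \sum_{p\in\mathcal Z}\sum_{t=1}^T\mathcal P_t(p)\bigl(\ell(p,y_t)-\ell(\sigma(p),y_t)\bigr)\ \le\ C\,T^{1/3}(\log T)^{2/3}.$$ -/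

import Mathlib

open Real

noncomputable section

/-- Log loss of the forecast `p ∈ [0, 1]` on the outcome `y` (`true` is `1`, `false` is `0`):
`-log p` if `y = 1` and `-log (1 - p)` if `y = 0`, with the value `⊤` when the logarithm is
taken at `0`. -/
def logLoss (p : ℝ) (y : Bool) : EReal :=
  -ENNReal.log (ENNReal.ofReal (if y then p else 1 - p))

/-- KL divergence between the Bernoulli distributions with means `q ∈ [0, 1]` and `p ∈ (0, 1)`.
Since `Real.log 0 = 0`, the convention `0 log 0 = 0` is built in. -/
def klBernoulli (q p : ℝ) : ℝ :=
  q * Real.log (q / p) + (1 - q) * Real.log ((1 - q) / (1 - p))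

/-- The numerical value of an outcome. -/
def outcome (y : Bool) : ℝ := if y then 1 else 0

/-! ### Pseudo calibration and pseudo swap regret

`Z` is a finite set of forecasts inside `(0, 1)`, `P t` is the probability mass function on `Z` of
the forecast in round `t`, `y t` is the outcome of round `t`, and the rounds are
`t = 0, …, T - 1`. -/

/-- The conditional frequency `ρ̃_p` of the outcome `1` given the forecast `p` (`0 / 0 = 0`). -/
def condFreq (P : ℕ → ℝ → ℝ) (y : ℕ → Bool) (T : ℕ) (p : ℝ) : ℝ :=
  (∑ t ∈ Finset.range T, outcome (y t) * P t p) / ∑ t ∈ Finset.range T, P t p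

/-- Pseudo KL-calibration error. -/
def pklCal (Z : Finset ℝ) (P : ℕ → ℝ → ℝ) (y : ℕ → Bool) (T : ℕ) : ℝ :=
  ∑ p ∈ Z, ∑ t ∈ Finset.range T, P t p * klBernoulli (condFreq P y T p) p

/-- Pseudo swap regret of the log loss. For `p ∈ Z` the loss `logLoss p (y t)` is finite, so no
difference `⊤ - ⊤` occurs; a swap to an infinite loss contributes `⊥` if `P t p > 0` and `0` if
`P t p = 0`. -/
def logPSReg (Z : Finset ℝ) (P : ℕ → ℝ → ℝ) (y : ℕ → Bool) (T : ℕ) : EReal :=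
  ⨆ σ : {σ : ℝ → ℝ // Set.MapsTo σ (Set.Icc 0 1) (Set.Icc 0 1)},
    ∑ p ∈ Z, ∑ t ∈ Finset.range T,
      ((P t p : ℝ) : EReal) * (logLoss p (y t) - logLoss (σ.1 p) (y t))

/-! ### The grid and the randomized rounding -/

/-- The non-uniform grid `z_0, …, z_K`. -/
def grid (K i : ℕ) : ℝ :=
  if i = 0 then Real.sin (π / (4 * K)) ^ 2
  else if i = K then Real.cos (π / (4 * K)) ^ 2
  else Real.sin (π * i / (2 * K)) ^ 2

/-- The set of grid points. -/
def gridSet (K : ℕ) : Finset ℝ :=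
  Finset.univ.image fun i : Fin (K + 1) => grid K i

open Classical in
/-- For `p ∈ [z_0, z_K)`, the index `i ∈ {0, …, K - 1}` with `p ∈ [z_i, z_{i+1})`. -/
def cell (K : ℕ) (p : ℝ) : ℕ :=
  Nat.findGreatest (fun i => grid K i ≤ p) (K - 1)

/-- Unnormalised weight of the lower neighbour `z_i` of `p ∈ [z_i, z_{i+1})`. -/
def lowerWeight (K i : ℕ) (p : ℝ) : ℝ :=
  (grid K (i + 1) - p) / (grid K (i + 1) * (1 - grid K (i + 1)))

/-- Unnormalised weight of the upper neighbour `z_{i+1}` of `p ∈ [z_i, z_{i+1})`. -/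
def upperWeight (K i : ℕ) (p : ℝ) : ℝ :=
  (p - grid K i) / (grid K i * (1 - grid K i))

/-- Randomized rounding for the log loss: `rround K p j` is the probability of `z_j`.
A point below `z_0` is sent to `z_0` and a point not below `z_K` is sent to `z_K`. -/
def rround (K : ℕ) (p : ℝ) (j : Fin (K + 1)) : ℝ :=
  if p < grid K 0 then (if (j : ℕ) = 0 then 1 else 0)
  else if grid K K ≤ p then (if (j : ℕ) = K then 1 else 0)
  else
    let i := cell K p
    let D := upperWeight K i p + lowerWeight K i p
    if (j : ℕ) = i then lowerWeight K i p / D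
    else if (j : ℕ) = i + 1 then upperWeight K i p / D
    else 0

/-! ### The algorithm

A forecaster with parameter `K` is a map `F` that assigns to each history of outcomes the
probability vector `F h` over the grid used in the next round. A history is a list with the most
recent outcome first. -/

/-- Cumulative scaled log loss `∑_τ f_{τ,i}(w)` along a history, where
`f_{τ,i}(w) = p_{τ,i} ℓ(w, y_τ)` and `p_τ` is the vector that `F` used in round `τ`.
For `w ∈ (0, 1)` every loss is finite; the endpoints do not affect the integrals below. -/
def cumLoss {K : ℕ} (F : List Bool → Fin (K + 1) → ℝ) (i : Fin (K + 1)) (w : ℝ) :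
    List Bool → ℝ
  | [] => 0
  | y :: h => cumLoss F i w h + F h i * (logLoss w y).toReal

/-- Output of the `i`-th exponentially weighted online optimizer on `[0, 1]` after the
history `h`. -/
def ewoo {K : ℕ} (F : List Bool → Fin (K + 1) → ℝ) (i : Fin (K + 1)) (h : List Bool) : ℝ :=
  (∫ w in (0 : ℝ)..1, w * Real.exp (-cumLoss F i w h)) /
    ∫ w in (0 : ℝ)..1, Real.exp (-cumLoss F i w h)

/-- The matrix of the Blum–Mansour reduction after the history `h`. Its `i`-th column is the
distribution proposed by the `i`-th sub-algorithm: column `i` of `Q₁` in the first round, and the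
rounded output of the `i`-th optimizer afterwards. -/
def bmMatrix {K : ℕ} (Q₁ : Matrix (Fin (K + 1)) (Fin (K + 1)) ℝ)
    (F : List Bool → Fin (K + 1) → ℝ) (h : List Bool) :
    Matrix (Fin (K + 1)) (Fin (K + 1)) ℝ :=
  Matrix.of fun j i => if h = [] then Q₁ j i else rround K (ewoo F i h) j

/-- `F` is an implementation of the Blum–Mansour reduction for the log loss with parameter `K` and
initial columns `Q₁`: after every history it plays some stationary distribution of the current
matrix. -/
def IsBMForecaster {K : ℕ} (Q₁ : Matrix (Fin (K + 1)) (Fin (K + 1)) ℝ)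
    (F : List Bool → Fin (K + 1) → ℝ) : Prop :=
  ∀ h : List Bool, F h ∈ stdSimplex ℝ (Fin (K + 1)) ∧ (bmMatrix Q₁ F h).mulVec (F h) = F h

/-- The history of the first `t` outcomes of `y`, most recent first. -/
def history (y : ℕ → Bool) : ℕ → List Bool
  | 0 => []
  | t + 1 => y t :: history y t

/-- The probability mass function `𝒫_t` of the forecast that `F` makes in round `t` against `y`. -/
def forecastPMF {K : ℕ} (F : List Bool → Fin (K + 1) → ℝ) (y : ℕ → Bool) (t : ℕ) (p : ℝ) : ℝ :=
  ∑ i : Fin (K + 1), if grid K i = p then F (history y t) i else 0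

end

/-!
The pseudo swap regret and the calibration error are the same quantity: the calibration error at
`p` is the regret, in log loss, of the forecast `p` against the conditional frequency `ρ̃_p`
(`sum_mul_klBernoulli`), and no swap does better than `p ↦ ρ̃_p` (`logPSReg_le_pklCal`). So it is
enough to bound the regret against `ρ̃`.

Stationarity `Q_t p_t = p_t` says that a forecast drawn from `p_t` can be drawn by choosing an
optimizer `i` from `p_t` and rounding its output `w_{t,i}`. The regret against `ρ̃` therefore splits
into two parts.

* Rounding (`rround_loss_le`). By `log x ≤ x - 1` the excess loss of rounding `p ∈ [a, b]` is at
  most a first-order term, and the weights are chosen so that this term is the same for both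
  outcomes. With `a = sin² θ`, `b = sin² φ` it is at most `tan² (φ - θ)`, and the grid is equally
  spaced in the angle, so that each round loses `O(1 / K²)`.
* Regret of the optimizers (`sum_ewoo_loss_le`). The posterior of the `i`-th optimizer has density
  `w ^ a (1 - w) ^ b`, where `a` and `b` are the weights of the outcomes seen so far. Each loss is
  exp-concave, so that the total loss is at most minus the logarithm of the mass of the density
  (`betaMass_update_le`), and this mass is at least `1 / (e (T + 1))` times the density at any
  point (`neg_log_betaMass_le`). Each optimizer has regret at most `log (T + 1) + 1`.

The first round, in which the columns are arbitrary, costs at most `-log z_0 = O(log K)`. The total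
`O(T / K² + K log T)` is balanced by the choice of `K` (`tuned_bound`).

The forecaster is built by recursion on the length of the history; a column-stochastic matrix has
a stationary distribution by linear algebra alone (`exists_stationary`).
-/

noncomputable section

/-! ### Likelihoods and log loss -/

/-- The probability that a Bernoulli variable with mean `p` assigns to the outcome `y`, so that the
log loss of `p` on `y` is `-log (bern p y)`. -/
def bern (p : ℝ) (y : Bool) : ℝ := if y then p else 1 - p

theorem bern_pos {p : ℝ} (h0 : 0 < p) (h1 : p < 1) (y : Bool) : 0 < bern p y := by
  cases y <;> simp [bern, h0, h1]

theorem bern_nonneg {p : ℝ} (h0 : 0 ≤ p) (h1 : p ≤ 1) (y : Bool) : 0 ≤ bern p y := by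
  cases y <;> simp [bern, h0, h1]

theorem bern_le_one {p : ℝ} (h0 : 0 ≤ p) (h1 : p ≤ 1) (y : Bool) : bern p y ≤ 1 := by
  cases y <;> simp [bern, h0, h1]

theorem logLoss_of_bern_pos {p : ℝ} {y : Bool} (h : 0 < bern p y) :
    logLoss p y = ((-Real.log (bern p y) : ℝ) : EReal) := by
  have h' : 0 < (if y then p else 1 - p) := h
  unfold logLoss
  rw [ENNReal.log_ofReal_of_pos h']
  simp [bern]

theorem logLoss_of_bern_nonpos {p : ℝ} {y : Bool} (h : bern p y ≤ 0) : logLoss p y = ⊤ := by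
  have h' : (if y then p else 1 - p) ≤ 0 := h
  unfold logLoss
  rw [ENNReal.ofReal_of_nonpos h']
  simp

/-- The real value of the log loss. At a zero likelihood both sides are the junk value `0`. -/
theorem logLoss_toReal {p : ℝ} {y : Bool} (h : 0 ≤ bern p y) :
    (logLoss p y).toReal = -Real.log (bern p y) := by
  rcases h.eq_or_lt with h | h
  · rw [logLoss_of_bern_nonpos h.symm.le, ← h]; simp
  · rw [logLoss_of_bern_pos h]; simp

/-! ### Calibration error and swap regret -/

section Calibration

variable {P : ℕ → ℝ → ℝ} {y : ℕ → Bool} {T : ℕ} {p : ℝ}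

theorem outcome_nonneg (y : Bool) : 0 ≤ outcome y := by cases y <;> simp [outcome]

theorem outcome_le_one (y : Bool) : outcome y ≤ 1 := by cases y <;> simp [outcome]

theorem condFreq_mem_Icc (hP : ∀ t, 0 ≤ P t p) :
    0 ≤ condFreq P y T p ∧ condFreq P y T p ≤ 1 := by
  constructor
  · exact div_nonneg (Finset.sum_nonneg fun t _ => mul_nonneg (outcome_nonneg _) (hP t))
      (Finset.sum_nonneg fun t _ => hP t)
  · exact div_le_one_of_le₀ (Finset.sum_le_sum fun t _ =>
      mul_le_of_le_one_left (hP t) (outcome_le_one _)) (Finset.sum_nonneg fun t _ => hP t)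

theorem condFreq_mul_sum (hP : ∀ t, 0 ≤ P t p) :
    condFreq P y T p * ∑ t ∈ Finset.range T, P t p
      = ∑ t ∈ Finset.range T, outcome (y t) * P t p := by
  unfold condFreq
  by_cases hN : ∑ t ∈ Finset.range T, P t p = 0
  · have h0 := (Finset.sum_eq_zero_iff_of_nonneg fun t _ => hP t).1 hN
    rw [hN, mul_zero, Finset.sum_eq_zero fun t ht => by rw [h0 t ht, mul_zero]]
  · exact div_mul_cancel₀ _ hN

/-- The rounds in which `p` is forecast split between the two outcomes in the proportions
`ρ : 1 - ρ`, where `ρ` is the conditional frequency. -/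
theorem sum_mul_ite_eq (f g : ℝ) (hP : ∀ t, 0 ≤ P t p) :
    ∑ t ∈ Finset.range T, P t p * (if y t then f else g)
      = (∑ t ∈ Finset.range T, P t p) *
        (condFreq P y T p * f + (1 - condFreq P y T p) * g) := by
  have h := condFreq_mul_sum (y := y) (T := T) hP
  have : ∀ t, P t p * (if y t then f else g)
      = outcome (y t) * P t p * f + (P t p - outcome (y t) * P t p) * g := by
    intro t; cases y t <;> simp [outcome]
  simp only [this, Finset.sum_add_distrib, ← Finset.sum_mul, Finset.sum_sub_distrib]
  rw [← h]; ring

/-- If the outcome `y t` has conditional frequency `0` given the forecast `p`, then `p` is not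
forecast in round `t`. -/
theorem eq_zero_of_bern_condFreq_eq_zero (hP : ∀ t, 0 ≤ P t p) {t : ℕ} (ht : t < T)
    (h : bern (condFreq P y T p) (y t) = 0) : P t p = 0 := by
  have h1 := sum_mul_ite_eq (y := y) (T := T) (if y t then 1 else 0) (if y t then 0 else 1) hP
  have h2 : condFreq P y T p * (if y t then 1 else 0)
      + (1 - condFreq P y T p) * (if y t then 0 else 1) = 0 := by
    refine Eq.trans ?_ h
    cases y t <;> simp [bern]
  rw [h2, mul_zero, Finset.sum_eq_zero_iff_of_nonneg] at h1
  · have := h1 t (Finset.mem_range.2 ht)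
    cases hy : y t <;> simpa [hy] using this
  · intro s _
    refine mul_nonneg (hP s) ?_
    split_ifs <;> norm_num

/-- The calibration error at `p` is the regret of `p`, in log loss, against the conditional
frequency. -/
theorem sum_mul_klBernoulli (hP : ∀ t, 0 ≤ P t p) (h0 : 0 < p) (h1 : p < 1) :
    ∑ t ∈ Finset.range T, P t p * klBernoulli (condFreq P y T p) p
      = ∑ t ∈ Finset.range T, P t p *
          (Real.log (bern (condFreq P y T p) (y t)) - Real.log (bern p (y t))) := by
  set ρ := condFreq P y T p with hρ
  have e : ∀ t, Real.log (bern ρ (y t)) - Real.log (bern p (y t))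
      = if y t then Real.log ρ - Real.log p else Real.log (1 - ρ) - Real.log (1 - p) := by
    intro t; cases y t <;> simp [bern]
  simp only [e]
  rw [sum_mul_ite_eq _ _ hP, ← hρ, ← Finset.sum_mul, klBernoulli]
  have key : ∀ q r : ℝ, 0 < r → q * Real.log (q / r) = q * (Real.log q - Real.log r) := by
    intro q r hr
    rcases eq_or_ne q 0 with rfl | hq
    · simp
    · rw [Real.log_div hq hr.ne']
  rw [key ρ p h0, key (1 - ρ) (1 - p) (by linarith)]

/-- The first-order change of the log-likelihood `log (bern ρ y)` when `ρ` is moved to `s`. -/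
def logTangent (ρ s : ℝ) (y : Bool) : ℝ := if y then (s - ρ) / ρ else (ρ - s) / (1 - ρ)

theorem log_bern_le_tangent {ρ s : ℝ} {y : Bool} (hρ : 0 < bern ρ y) (hs : 0 < bern s y) :
    Real.log (bern s y) ≤ Real.log (bern ρ y) + logTangent ρ s y := by
  have h := Real.log_le_sub_one_of_pos (div_pos hs hρ)
  rw [Real.log_div hs.ne' hρ.ne'] at h
  have e : bern s y / bern ρ y - 1 = logTangent ρ s y := by
    cases y <;> simp only [bern, logTangent, if_true, if_false, Bool.false_eq_true] at hρ ⊢ <;>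
      field_simp
    ring
  linarith

/-- One term of the swap regret, bounded by concavity of `log` at the conditional frequency. The
bound is finite also where the swap has infinite loss, which makes the sum over `t` a real one. -/
theorem swap_term_le (hP : ∀ t, 0 ≤ P t p) (h0 : 0 < p) (h1 : p < 1) {s : ℝ}
    {t : ℕ} (ht : t < T) :
    ((P t p : ℝ) : EReal) * (logLoss p (y t) - logLoss s (y t))
      ≤ ((P t p * (Real.log (bern (condFreq P y T p) (y t)) - Real.log (bern p (y t))
          + logTangent (condFreq P y T p) s (y t)) : ℝ) : EReal) := by
  rcases (hP t).eq_or_lt with hz | hpos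
  · rw [← hz]; simp
  have hρ : 0 < bern (condFreq P y T p) (y t) :=
    (bern_nonneg (condFreq_mem_Icc hP).1 (condFreq_mem_Icc hP).2 _).lt_of_ne' fun h =>
      hpos.ne' (eq_zero_of_bern_condFreq_eq_zero hP ht h)
  rw [logLoss_of_bern_pos (bern_pos h0 h1 (y t))]
  rcases le_or_gt (bern s (y t)) 0 with hs | hs
  · rw [logLoss_of_bern_nonpos hs, EReal.sub_top, EReal.coe_mul_bot_of_pos hpos]
    exact bot_le
  · rw [logLoss_of_bern_pos hs, ← EReal.coe_sub, ← EReal.coe_mul, EReal.coe_le_coe_iff]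
    refine mul_le_mul_of_nonneg_left ?_ hpos.le
    have := log_bern_le_tangent hρ hs
    linarith

/-- The conditional frequency maximizes the log-likelihood to first order: the tangent terms cancel
when it lies inside `(0, 1)`, and their sum is nonpositive when it is an endpoint. -/
theorem sum_logTangent_nonpos (hP : ∀ t, 0 ≤ P t p) {s : ℝ} (hs : s ∈ Set.Icc (0 : ℝ) 1) :
    ∑ t ∈ Finset.range T, P t p * logTangent (condFreq P y T p) s (y t) ≤ 0 := by
  unfold logTangent
  rw [sum_mul_ite_eq _ _ hP]
  refine mul_nonpos_of_nonneg_of_nonpos (Finset.sum_nonneg fun t _ => hP t) ?_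
  set ρ := condFreq P y T p
  rcases eq_or_ne ρ 0 with h | h
  · simp [h, hs.1]
  rcases eq_or_ne (1 - ρ) 0 with h' | h'
  · rw [h']
    have : ρ = 1 := by linarith
    simp [this, hs.2]
  · rw [mul_div_cancel₀ _ h, mul_div_cancel₀ _ h']; linarith

/-- No swap is better than the swap to the conditional frequencies. -/
theorem logPSReg_le_pklCal {Z : Finset ℝ} (hP : ∀ t p, 0 ≤ P t p)
    (hZ : ∀ p ∈ Z, 0 < p ∧ p < 1) :
    logPSReg Z P y T ≤ ((pklCal Z P y T : ℝ) : EReal) := by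
  refine iSup_le fun σ => ?_
  have hcoe : ∀ {ι : Type} (s : Finset ι) (f : ι → ℝ),
      ∑ i ∈ s, ((f i : ℝ) : EReal) = ((∑ i ∈ s, f i : ℝ) : EReal) := by
    intro ι s f
    induction s using Finset.cons_induction with
    | empty => simp
    | cons a s ha ih => rw [Finset.sum_cons, Finset.sum_cons, ih, EReal.coe_add]
  unfold pklCal
  rw [← hcoe]
  refine Finset.sum_le_sum fun p hp => ?_
  obtain ⟨h0, h1⟩ := hZ p hp
  refine (Finset.sum_le_sum fun t ht => swap_term_le (fun t => hP t p) h0 h1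
    (Finset.mem_range.1 ht)).trans ?_
  rw [hcoe, EReal.coe_le_coe_iff, sum_mul_klBernoulli (fun t => hP t p) h0 h1]
  simp only [mul_add, Finset.sum_add_distrib]
  have := sum_logTangent_nonpos (y := y) (T := T) (fun t => hP t p)
    (σ.2 (⟨h0.le, h1.le⟩ : p ∈ Set.Icc (0 : ℝ) 1))
  linarith

end Calibration

/-! ### The grid -/

/-- The angle `θ_i` with `z_i = sin² θ_i`. -/
def gridAngle (K i : ℕ) : ℝ :=
  if i = 0 then π / (4 * K) else if i = K then π / 2 - π / (4 * K) else π * i / (2 * K)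

theorem grid_eq_sin_sq (K i : ℕ) : grid K i = Real.sin (gridAngle K i) ^ 2 := by
  unfold grid gridAngle
  split_ifs
  · rfl
  · rw [Real.sin_pi_div_two_sub]
  · rfl

theorem gridAngle_bounds {K i : ℕ} (hK : 1 ≤ K) (hi : i ≤ K) :
    π / (4 * K) ≤ gridAngle K i ∧ gridAngle K i ≤ π / 2 - π / (4 * K) := by
  have hK' : (1 : ℝ) ≤ K := by exact_mod_cast hK
  have hpi := Real.pi_pos
  have e : π / 2 = (2 * K) * (π / (4 * K)) := by field_simp; norm_num
  have hq : 0 < π / (4 * K) := by positivity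
  unfold gridAngle
  split_ifs with h0 h1
  · refine ⟨le_rfl, ?_⟩
    rw [e]; nlinarith
  · refine ⟨?_, le_rfl⟩
    rw [e]; nlinarith
  · have e' : π * i / (2 * K) = (2 * i) * (π / (4 * K)) := by field_simp; norm_num
    have hi1 : (1 : ℝ) ≤ i := by exact_mod_cast Nat.one_le_iff_ne_zero.2 h0
    have hi2 : (i : ℝ) + 1 ≤ K := by exact_mod_cast Nat.lt_of_le_of_ne hi h1
    rw [e, e']
    constructor <;> nlinarith

theorem gridAngle_succ_sub {K i : ℕ} (hK : 2 ≤ K) (hi : i < K) :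
    0 ≤ gridAngle K (i + 1) - gridAngle K i ∧
      gridAngle K (i + 1) - gridAngle K i ≤ π / (2 * K) := by
  have hK' : (2 : ℝ) ≤ K := by exact_mod_cast hK
  have hq : 0 < π / (4 * K) := by positivity
  have e : π / 2 = (2 * K) * (π / (4 * K)) := by field_simp; norm_num
  have e2 : π / (2 * K) = 2 * (π / (4 * K)) := by field_simp; norm_num
  have e' : ∀ j : ℝ, π * j / (2 * K) = (2 * j) * (π / (4 * K)) := by
    intro j; field_simp; norm_num
  unfold gridAngle
  rw [if_neg (Nat.succ_ne_zero i), e, e', e', e2]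
  generalize π / (4 * (K : ℝ)) = q at hq ⊢
  split_ifs with h1 h2 h3 h2 h3
  · omega
  · omega
  · have : (K : ℝ) = i + 1 := by exact_mod_cast h1.symm
    rw [this]
    constructor <;> nlinarith
  · subst h2
    push_cast
    constructor <;> nlinarith
  · omega
  · push_cast
    constructor <;> nlinarith

theorem grid_pos {K i : ℕ} (hK : 1 ≤ K) (hi : i ≤ K) : 0 < grid K i := by
  have hK' : (1 : ℝ) ≤ K := by exact_mod_cast hK
  have hq : 0 < π / (4 * K) := by positivity
  have h := gridAngle_bounds hK hi
  rw [grid_eq_sin_sq]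
  have := Real.sin_pos_of_pos_of_lt_pi (x := gridAngle K i) (by linarith)
    (by linarith [Real.pi_pos])
  positivity

theorem grid_lt_one {K i : ℕ} (hK : 1 ≤ K) (hi : i ≤ K) : grid K i < 1 := by
  have hK' : (1 : ℝ) ≤ K := by exact_mod_cast hK
  have hq : 0 < π / (4 * K) := by positivity
  have h := gridAngle_bounds hK hi
  have := Real.cos_pos_of_mem_Ioo (x := gridAngle K i) ⟨by linarith [Real.pi_pos], by linarith⟩
  rw [grid_eq_sin_sq, Real.sin_sq]
  have : 0 < Real.cos (gridAngle K i) ^ 2 := by positivity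
  linarith

theorem sin_sq_lower {K : ℕ} (hK : 1 ≤ K) :
    (1 / (2 * K : ℝ)) ^ 2 ≤ Real.sin (π / (4 * K)) ^ 2 := by
  have hK' : (1 : ℝ) ≤ K := by exact_mod_cast hK
  have hpi := Real.pi_pos
  have h := Real.mul_le_sin (x := π / (4 * K)) (by positivity)
    (by rw [div_le_div_iff₀ (by positivity) (by norm_num)]; nlinarith)
  have e : 2 / π * (π / (4 * K)) = 1 / (2 * K) := by field_simp; norm_num
  rw [e] at h
  exact pow_le_pow_left₀ (by positivity) h 2

/-- Every grid point is at distance at least `sin² (π / 4K) ≥ 1 / (2K)²` from both endpoints. -/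
theorem neg_log_bern_grid_le {K i : ℕ} (hK : 1 ≤ K) (hi : i ≤ K) (y : Bool) :
    -Real.log (bern (grid K i) y) ≤ 2 * Real.log (2 * K) := by
  have hK' : (1 : ℝ) ≤ K := by exact_mod_cast hK
  have hq : 0 < π / (4 * K) := by positivity
  have h := gridAngle_bounds hK hi
  have hpi := Real.pi_pos
  have hlow : (1 / (2 * K : ℝ)) ^ 2 ≤ bern (grid K i) y := by
    refine (sin_sq_lower hK).trans ?_
    have hs : 0 ≤ Real.sin (π / (4 * K)) :=
      Real.sin_nonneg_of_nonneg_of_le_pi hq.le (by linarith)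
    cases y
    · simp only [bern, grid_eq_sin_sq, Bool.false_eq_true, if_false, ← Real.cos_sq']
      refine pow_le_pow_left₀ hs ?_ 2
      rw [← Real.sin_pi_div_two_sub]
      exact Real.sin_le_sin_of_le_of_le_pi_div_two (by linarith) (by linarith) (by linarith)
    · simp only [bern, grid_eq_sin_sq, if_true]
      refine pow_le_pow_left₀ hs ?_ 2
      exact Real.sin_le_sin_of_le_of_le_pi_div_two (by linarith) (by linarith) (by linarith)
  have := Real.log_le_log (by positivity) hlow
  rw [Real.log_pow, one_div, Real.log_inv] at this
  push_cast at this
  linarith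

/-! ### Randomized rounding -/

theorem cell_spec {K : ℕ} (hK : 1 ≤ K) {p : ℝ} (h0 : grid K 0 ≤ p) (h1 : p < grid K K) :
    cell K p < K ∧ grid K (cell K p) ≤ p ∧ p < grid K (cell K p + 1) := by
  have hle : cell K p ≤ K - 1 := Nat.findGreatest_le _
  refine ⟨by omega, ?_, ?_⟩
  · exact Nat.findGreatest_spec (P := fun i => grid K i ≤ p) (Nat.zero_le _) h0
  · rcases hle.eq_or_lt with h | h
    · rw [h, Nat.sub_add_cancel hK]; exact h1
    · exact not_le.1 (Nat.findGreatest_is_greatest (P := fun i => grid K i ≤ p)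
        (Nat.lt_succ_self _) h)

theorem lowerWeight_pos {K i : ℕ} (hK : 1 ≤ K) (hi : i < K) {p : ℝ} (h : p < grid K (i + 1)) :
    0 < lowerWeight K i p :=
  div_pos (sub_pos.2 h) (mul_pos (grid_pos hK hi) (sub_pos.2 (grid_lt_one hK hi)))

theorem upperWeight_nonneg {K i : ℕ} (hK : 1 ≤ K) (hi : i < K) {p : ℝ} (h : grid K i ≤ p) :
    0 ≤ upperWeight K i p :=
  div_nonneg (sub_nonneg.2 h)
    (mul_nonneg (grid_pos hK hi.le).le (sub_nonneg.2 (grid_lt_one hK hi.le).le))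

theorem sum_rround_mul {K : ℕ} (hK : 1 ≤ K) (p : ℝ) (g : ℕ → ℝ) :
    ∑ j : Fin (K + 1), rround K p j * g j =
      if p < grid K 0 then g 0 else if grid K K ≤ p then g K
      else (lowerWeight K (cell K p) p * g (cell K p)
        + upperWeight K (cell K p) p * g (cell K p + 1))
          / (upperWeight K (cell K p) p + lowerWeight K (cell K p) p) := by
  simp only [rround]
  split_ifs with h0 h1
  · rw [Finset.sum_eq_single (0 : Fin (K + 1))]
    · simp
    · intro j _ hj
      rw [if_neg fun h : (j : ℕ) = 0 => hj (Fin.ext h), zero_mul]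
    · simp
  · rw [Finset.sum_eq_single (Fin.last K)]
    · simp
    · intro j _ hj
      rw [if_neg fun h : (j : ℕ) = K => hj (Fin.ext h), zero_mul]
    · simp
  · obtain ⟨hc, -, -⟩ := cell_spec hK (not_lt.1 h0) (not_le.1 h1)
    set i := cell K p
    have hne : (⟨i, by omega⟩ : Fin (K + 1)) ≠ ⟨i + 1, by omega⟩ := by simp [Fin.ext_iff]
    rw [Finset.sum_eq_add (⟨i, by omega⟩ : Fin (K + 1)) ⟨i + 1, by omega⟩ hne]
    · simp; ring
    · rintro ⟨j, hj⟩ - ⟨h2, h3⟩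
      simp only [ne_eq, Fin.mk.injEq] at h2 h3
      simp [h2, h3]
    · simp
    · simp

theorem rround_nonneg {K : ℕ} (hK : 1 ≤ K) (p : ℝ) (j : Fin (K + 1)) : 0 ≤ rround K p j := by
  unfold rround
  by_cases h0 : p < grid K 0
  · rw [if_pos h0]; split_ifs <;> norm_num
  by_cases h1 : grid K K ≤ p
  · rw [if_neg h0, if_pos h1]; split_ifs <;> norm_num
  obtain ⟨hc, ha, hb⟩ := cell_spec hK (not_lt.1 h0) (not_le.1 h1)
  have hl := lowerWeight_pos hK hc hb
  have hu := upperWeight_nonneg hK hc ha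
  rw [if_neg h0, if_neg h1]
  dsimp only
  split_ifs <;> positivity

theorem sum_rround {K : ℕ} (hK : 1 ≤ K) (p : ℝ) : ∑ j : Fin (K + 1), rround K p j = 1 := by
  have h := sum_rround_mul hK p fun _ => 1
  simp only [mul_one] at h
  rw [h]
  split_ifs with h0 h1
  · rfl
  · rfl
  · obtain ⟨hc, ha, hb⟩ := cell_spec hK (not_lt.1 h0) (not_le.1 h1)
    have hl := lowerWeight_pos hK hc hb
    have hu := upperWeight_nonneg hK hc ha
    rw [add_comm, div_self (by positivity)]

theorem neg_log_sub_le {x z : ℝ} (hx : 0 < x) (hz : 0 < z) :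
    -Real.log z ≤ -Real.log x + (x - z) / z := by
  have h := Real.log_le_sub_one_of_pos (div_pos hx hz)
  rw [Real.log_div hx.ne' hz.ne'] at h
  have : x / z - 1 = (x - z) / z := by field_simp
  linarith

/-- The weights make the first-order excess loss of rounding `p ∈ [a, b]` to `{a, b}` the same for
both outcomes. -/
theorem rounding_excess_eq {a b p : ℝ} (ha : 0 < a) (hb : b < 1) (hap : a ≤ p) (hpb : p < b)
    (y : Bool) :
    ((b - p) / (b * (1 - b)) * ((bern p y - bern a y) / bern a y)
      + (p - a) / (a * (1 - a)) * ((bern p y - bern b y) / bern b y))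
        / ((p - a) / (a * (1 - a)) + (b - p) / (b * (1 - b)))
      = (b - p) * (p - a) * (b - a) / ((b - p) * (a * (1 - a)) + (p - a) * (b * (1 - b))) := by
  have hb0 : 0 < b := by linarith
  have h1a : 0 < 1 - a := by linarith
  have h1b : 0 < 1 - b := by linarith
  have hbp : 0 < b - p := by linarith
  have hpa : 0 ≤ p - a := by linarith
  have hD : 0 < (b - p) * (a * (1 - a)) + (p - a) * (b * (1 - b)) := by positivity
  have hD' : (p - a) / (a * (1 - a)) + (b - p) / (b * (1 - b))
      = ((b - p) * (a * (1 - a)) + (p - a) * (b * (1 - b))) / (a * (1 - a) * (b * (1 - b))) := by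
    field_simp; ring
  rw [hD', div_div_eq_mul_div, div_left_inj' hD.ne']
  cases y <;> simp only [bern, Bool.false_eq_true, if_false, if_true] <;> field_simp <;> ring

/-- The excess is at most `((b - a) / (√(a (1 - a)) + √(b (1 - b))))²`, which for
`a = sin² θ` and `b = sin² φ` is `tan² (φ - θ)`. -/
theorem rounding_excess_le {θ φ p : ℝ} (hθ : 0 < θ) (hθφ : θ ≤ φ) (hφ : φ < π / 2)
    (hd : φ - θ ≤ π / 4) (hap : Real.sin θ ^ 2 ≤ p) (hpb : p < Real.sin φ ^ 2) :
    (Real.sin φ ^ 2 - p) * (p - Real.sin θ ^ 2) * (Real.sin φ ^ 2 - Real.sin θ ^ 2)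
      / ((Real.sin φ ^ 2 - p) * (Real.sin θ ^ 2 * (1 - Real.sin θ ^ 2))
        + (p - Real.sin θ ^ 2) * (Real.sin φ ^ 2 * (1 - Real.sin φ ^ 2)))
      ≤ 2 * (φ - θ) ^ 2 := by
  have hpi := Real.pi_pos
  have hsθ : 0 < Real.sin θ := Real.sin_pos_of_pos_of_lt_pi hθ (by linarith)
  have hcθ : 0 < Real.cos θ := Real.cos_pos_of_mem_Ioo ⟨by linarith, by linarith⟩
  have hsφ : 0 < Real.sin φ := Real.sin_pos_of_pos_of_lt_pi (by linarith) (by linarith)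
  have hcφ : 0 < Real.cos φ := Real.cos_pos_of_mem_Ioo ⟨by linarith, by linarith⟩
  have hS : 0 < Real.sin (φ + θ) := Real.sin_pos_of_pos_of_lt_pi (by linarith) (by linarith)
  rw [← Real.cos_sq', ← Real.cos_sq', ← mul_pow, ← mul_pow]
  set u := Real.sin φ ^ 2 - p with hu
  set v := p - Real.sin θ ^ 2 with hv
  have hu0 : 0 < u := by linarith
  have hv0 : 0 ≤ v := by linarith
  set s := Real.sin θ * Real.cos θ with hs
  set r := Real.sin φ * Real.cos φ with hr
  have hs0 : 0 < s := by positivity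
  have hr0 : 0 < r := by positivity
  have hdiff : Real.sin φ ^ 2 - Real.sin θ ^ 2 = Real.sin (φ - θ) * Real.sin (φ + θ) := by
    rw [Real.sin_sub, Real.sin_add]
    nlinarith [Real.sin_sq_add_cos_sq φ, Real.sin_sq_add_cos_sq θ]
  have hsum : s + r = Real.sin (φ + θ) * Real.cos (φ - θ) := by
    rw [hs, hr, Real.cos_sub, Real.sin_add]
    linear_combination (-(Real.sin φ * Real.cos φ)) * Real.sin_sq_add_cos_sq θ
      - (Real.sin θ * Real.cos θ) * Real.sin_sq_add_cos_sq φ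
  have huv : u + v = Real.sin φ ^ 2 - Real.sin θ ^ 2 := by rw [hu, hv]; ring
  have hcos : 1 / 2 ≤ Real.cos (φ - θ) ^ 2 := by
    have h := Real.cos_le_cos_of_nonneg_of_le_pi (x := φ - θ) (y := π / 4)
      (by linarith) (by linarith) hd
    have h2 := pow_le_pow_left₀ (by rw [Real.cos_pi_div_four]; positivity) h 2
    rw [Real.cos_pi_div_four, div_pow, Real.sq_sqrt (by norm_num)] at h2
    norm_num at h2 ⊢
    exact h2
  have hsin : Real.sin (φ - θ) ^ 2 ≤ (φ - θ) ^ 2 := by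
    refine pow_le_pow_left₀ ?_ (Real.sin_le (by linarith)) 2
    exact Real.sin_nonneg_of_nonneg_of_le_pi (by linarith) (by linarith)
  have hdsq : (u + v) ^ 2 ≤ 2 * (φ - θ) ^ 2 * (s + r) ^ 2 := by
    rw [huv, hdiff, hsum, mul_pow, mul_pow]
    have : 0 ≤ (φ - θ) ^ 2 := sq_nonneg _
    nlinarith [mul_le_mul_of_nonneg_right hsin (sq_nonneg (Real.sin (φ + θ))),
      mul_le_mul_of_nonneg_left hcos (mul_nonneg this (sq_nonneg (Real.sin (φ + θ))))]
  rw [← huv, div_le_iff₀ (by positivity)]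
  -- Cauchy–Schwarz: `u v (s + r)² ≤ (u + v) (u s² + v r²)`.
  have hcs : u * v * (s + r) ^ 2 ≤ (u + v) * (u * s ^ 2 + v * r ^ 2) := by
    nlinarith [sq_nonneg (u * s - v * r)]
  have hw : 0 < u + v := by linarith
  have hX : 0 ≤ 2 * (φ - θ) ^ 2 := by positivity
  have hchain : (u + v) * (u * v * (u + v)) ≤
      (u + v) * (2 * (φ - θ) ^ 2 * (u * s ^ 2 + v * r ^ 2)) := by
    calc (u + v) * (u * v * (u + v)) = u * v * (u + v) ^ 2 := by ring
      _ ≤ u * v * (2 * (φ - θ) ^ 2 * (s + r) ^ 2) := by gcongr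
      _ = 2 * (φ - θ) ^ 2 * (u * v * (s + r) ^ 2) := by ring
      _ ≤ 2 * (φ - θ) ^ 2 * ((u + v) * (u * s ^ 2 + v * r ^ 2)) := by gcongr
      _ = _ := by ring
  exact le_of_mul_le_mul_left hchain hw

theorem two_mul_angle_sq_le {K : ℕ} (hK : 1 ≤ K) {x : ℝ} (hx0 : 0 ≤ x) (hx : x ≤ π / (2 * K)) :
    2 * x ^ 2 ≤ 8 / (K : ℝ) ^ 2 := by
  have hK' : (1 : ℝ) ≤ K := by exact_mod_cast hK
  have h2 : x ≤ 2 / K := by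
    refine hx.trans ?_
    rw [div_le_div_iff₀ (by positivity) (by positivity)]
    nlinarith [Real.pi_le_four]
  calc 2 * x ^ 2 ≤ 2 * (2 / K) ^ 2 := by gcongr
    _ = 8 / (K : ℝ) ^ 2 := by ring

/-- Beyond the extreme grid points rounding costs at most `tan² (π / 4K)`. -/
theorem neg_log_cos_sq_le {K : ℕ} (hK : 1 ≤ K) :
    -Real.log (Real.cos (π / (4 * K)) ^ 2) ≤ 8 / (K : ℝ) ^ 2 := by
  have hK' : (1 : ℝ) ≤ K := by exact_mod_cast hK
  have hpi := Real.pi_pos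
  have hq : 0 < π / (4 * K) := by positivity
  have hq4 : π / (4 * K) ≤ π / 4 := by
    rw [div_le_div_iff₀ (by positivity) (by positivity)]; nlinarith
  have hsin : Real.sin (π / (4 * K)) ^ 2 ≤ (π / (4 * K)) ^ 2 := by
    refine pow_le_pow_left₀ ?_ (Real.sin_le hq.le) 2
    exact Real.sin_nonneg_of_nonneg_of_le_pi hq.le (by linarith)
  have hcos : 1 / 2 ≤ Real.cos (π / (4 * K)) ^ 2 := by
    have h := Real.cos_le_cos_of_nonneg_of_le_pi hq.le (by linarith) hq4
    have h2 := pow_le_pow_left₀ (by rw [Real.cos_pi_div_four]; positivity) h 2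
    rw [Real.cos_pi_div_four, div_pow, Real.sq_sqrt (by norm_num)] at h2
    norm_num at h2 ⊢
    exact h2
  refine le_trans ?_ (two_mul_angle_sq_le hK hq.le ?_)
  · have h := neg_log_sub_le (x := 1) (z := Real.cos (π / (4 * K)) ^ 2) one_pos (by linarith)
    rw [Real.log_one, neg_zero, zero_add, ← Real.sin_sq] at h
    refine h.trans ?_
    rw [div_le_iff₀ (by linarith)]
    nlinarith [sq_nonneg (π / (4 * K))]
  · rw [div_le_div_iff₀ (by positivity) (by positivity)]; nlinarith

theorem neg_log_bern_nonneg {w : ℝ} (h0 : 0 ≤ w) (h1 : w ≤ 1) (y : Bool) :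
    0 ≤ -Real.log (bern w y) :=
  neg_nonneg.2 (Real.log_nonpos (bern_nonneg h0 h1 y) (bern_le_one h0 h1 y))

/-- Rounding raises the expected log loss by `O(1 / K²)`, whatever the outcome. -/
theorem rround_loss_le {K : ℕ} (hK : 1 ≤ K) {w : ℝ} (hw0 : 0 < w) (hw1 : w < 1) (y : Bool) :
    ∑ j : Fin (K + 1), rround K w j * -Real.log (bern (grid K j) y)
      ≤ -Real.log (bern w y) + 8 / (K : ℝ) ^ 2 := by
  have hK' : (1 : ℝ) ≤ K := by exact_mod_cast hK
  have hK0 : K ≠ 0 := by omega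
  have hw := neg_log_bern_nonneg hw0.le hw1.le y
  have h8 : 0 ≤ 8 / (K : ℝ) ^ 2 := by positivity
  rw [sum_rround_mul hK w fun j => -Real.log (bern (grid K j) y)]
  split_ifs with h0 h1
  · cases y
    · have e : bern (grid K 0) false = Real.cos (π / (4 * K)) ^ 2 := by
        simp [bern, grid, Real.cos_sq']
      rw [e]; linarith [neg_log_cos_sq_le hK]
    · have : Real.log w ≤ Real.log (grid K 0) := Real.log_le_log hw0 h0.le
      simp only [bern, if_true] at hw ⊢
      linarith
  · cases y
    · have : Real.log (1 - w) ≤ Real.log (1 - grid K K) :=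
        Real.log_le_log (by linarith) (by linarith)
      simp only [bern, Bool.false_eq_true, if_false] at hw ⊢
      linarith
    · have e : bern (grid K K) true = Real.cos (π / (4 * K)) ^ 2 := by
        simp [bern, grid, hK0]
      rw [e]; linarith [neg_log_cos_sq_le hK]
  · obtain ⟨hc, ha, hb⟩ := cell_spec hK (not_lt.1 h0) (not_le.1 h1)
    have hl := lowerWeight_pos hK hc hb
    have hu := upperWeight_nonneg hK hc ha
    set i := cell K w
    have hK2 : 2 ≤ K := by
      -- For `K = 1` both grid points are `1 / 2`, and there is no cell.
      by_contra hlt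
      have hK1 : K = 1 := by omega
      apply h1
      rw [not_lt] at h0
      subst hK1
      have : grid 1 1 = grid 1 0 := by simp [grid, Real.cos_pi_div_four, Real.sin_pi_div_four]
      rw [this]; exact h0
    have hbw := bern_pos hw0 hw1 y
    have ha' := neg_log_sub_le hbw (bern_pos (grid_pos hK hc.le) (grid_lt_one hK hc.le) y)
    have hb' := neg_log_sub_le hbw (bern_pos (grid_pos hK hc) (grid_lt_one hK hc) y)
    have hang := gridAngle_succ_sub hK2 hc
    have hpi := Real.pi_pos
    have hq : 0 < π / (4 * K) := by positivity
    have hex := rounding_excess_eq (grid_pos hK hc.le) (grid_lt_one hK hc) ha hb y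
    have hquart : π / (2 * K) ≤ π / 4 := by
      have : (2 : ℝ) ≤ K := by exact_mod_cast hK2
      rw [div_le_div_iff₀ (by positivity) (by positivity)]; nlinarith
    have hle : _ ≤ 2 * (gridAngle K (i + 1) - gridAngle K i) ^ 2 :=
      rounding_excess_le (p := w) (by linarith [(gridAngle_bounds hK hc.le).1])
        (by linarith [hang.1]) (by linarith [(gridAngle_bounds hK hc).2])
        (by linarith [hang.2]) (by rw [← grid_eq_sin_sq]; exact ha)
        (by rw [← grid_eq_sin_sq]; exact hb)
    rw [← grid_eq_sin_sq, ← grid_eq_sin_sq, ← hex] at hle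
    have htot := hle.trans (two_mul_angle_sq_le hK hang.1 hang.2)
    change (lowerWeight K i w * _ + upperWeight K i w * _)
      / (upperWeight K i w + lowerWeight K i w) ≤ _ at htot
    have hD : 0 < upperWeight K i w + lowerWeight K i w := by positivity
    rw [div_le_iff₀ hD] at htot ⊢
    have h1' := mul_le_mul_of_nonneg_left ha' hl.le
    have h2' := mul_le_mul_of_nonneg_left hb' hu
    linarith

/-! ### The exponentially weighted optimizer -/

/-- The unnormalised posterior density `w ^ a * (1 - w) ^ b` of the optimizer that has seen total
weight `a` of the outcome `1` and `b` of the outcome `0`. -/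
def betaDensity (a b w : ℝ) : ℝ := w ^ a * (1 - w) ^ b

/-- The total mass `B(a + 1, b + 1)` of the posterior density. -/
def betaMass (a b : ℝ) : ℝ := ∫ w in (0 : ℝ)..1, betaDensity a b w

/-- The posterior mean. -/
def betaMean (a b : ℝ) : ℝ := (∫ w in (0 : ℝ)..1, w * betaDensity a b w) / betaMass a b

section Beta

variable {a b : ℝ}

theorem continuous_betaDensity (ha : 0 ≤ a) (hb : 0 ≤ b) : Continuous (betaDensity a b) :=
  (Real.continuous_rpow_const ha).mul
    ((Real.continuous_rpow_const hb).comp (continuous_const.sub continuous_id))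

theorem betaDensity_pos {w : ℝ} (h0 : 0 < w) (h1 : w < 1) : 0 < betaDensity a b w :=
  mul_pos (Real.rpow_pos_of_pos h0 _) (Real.rpow_pos_of_pos (sub_pos.2 h1) _)

theorem betaDensity_nonneg {w : ℝ} (h0 : 0 ≤ w) (h1 : w ≤ 1) : 0 ≤ betaDensity a b w :=
  mul_nonneg (Real.rpow_nonneg h0 _) (Real.rpow_nonneg (sub_nonneg.2 h1) _)

theorem betaMass_pos (ha : 0 ≤ a) (hb : 0 ≤ b) : 0 < betaMass a b :=
  intervalIntegral.intervalIntegral_pos_of_pos_on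
    ((continuous_betaDensity ha hb).intervalIntegrable _ _)
    (fun _ hw => betaDensity_pos hw.1 hw.2) one_pos

theorem betaMean_pos (ha : 0 ≤ a) (hb : 0 ≤ b) : 0 < betaMean a b := by
  refine div_pos ?_ (betaMass_pos ha hb)
  exact intervalIntegral.intervalIntegral_pos_of_pos_on
    ((continuous_id.mul (continuous_betaDensity ha hb)).intervalIntegrable _ _)
    (fun _ hw => mul_pos hw.1 (betaDensity_pos hw.1 hw.2)) one_pos

theorem one_sub_betaMean (ha : 0 ≤ a) (hb : 0 ≤ b) :
    1 - betaMean a b = (∫ w in (0 : ℝ)..1, (1 - w) * betaDensity a b w) / betaMass a b := by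
  have hc := continuous_betaDensity ha hb
  have h : ∫ w in (0 : ℝ)..1, (1 - w) * betaDensity a b w
      = betaMass a b - ∫ w in (0 : ℝ)..1, w * betaDensity a b w := by
    rw [betaMass, ← intervalIntegral.integral_sub (hc.intervalIntegrable _ _)
      (Continuous.intervalIntegrable (by fun_prop) _ _)]
    exact intervalIntegral.integral_congr fun w _ => by ring
  rw [h, sub_div, div_self (betaMass_pos ha hb).ne', betaMean]

theorem betaMean_lt_one (ha : 0 ≤ a) (hb : 0 ≤ b) : betaMean a b < 1 := by
  rw [← sub_pos, one_sub_betaMean ha hb]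
  refine div_pos ?_ (betaMass_pos ha hb)
  exact intervalIntegral.intervalIntegral_pos_of_pos_on
    (((continuous_const.sub continuous_id).mul
      (continuous_betaDensity ha hb)).intervalIntegrable _ _)
    (fun _ hw => mul_pos (sub_pos.2 hw.2) (betaDensity_pos hw.1 hw.2)) one_pos

theorem integral_bern_mul_betaDensity (ha : 0 ≤ a) (hb : 0 ≤ b) (y : Bool) :
    ∫ w in (0 : ℝ)..1, bern w y * betaDensity a b w = bern (betaMean a b) y * betaMass a b := by
  have hne := (betaMass_pos ha hb).ne'
  cases y <;> simp only [bern, if_true, if_false, Bool.false_eq_true]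
  · rw [one_sub_betaMean ha hb, div_mul_cancel₀ _ hne]
  · rw [betaMean, div_mul_cancel₀ _ hne]

/-- The `p`-scaled log loss is exp-concave for `p ≤ 1`: the likelihood `x ^ p` lies below its
tangent at `m`. -/
theorem rpow_le_tangent {x m p : ℝ} (hx : 0 ≤ x) (hm : 0 < m) (hp0 : 0 ≤ p) (hp1 : p ≤ 1) :
    x ^ p ≤ m ^ p * (p * (x / m) + (1 - p)) := by
  have h := rpow_one_add_le_one_add_mul_self (s := x / m - 1)
    (by have := div_nonneg hx hm.le; linarith) hp0 hp1
  have e : (1 + (x / m - 1)) = x / m := by ring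
  rw [e, Real.div_rpow hx hm.le, div_le_iff₀ (Real.rpow_pos_of_pos hm p)] at h
  linarith

/-- The posterior parameters after an outcome of weight `p`. -/
theorem betaDensity_update {w : ℝ} (h0 : 0 < w) (h1 : w < 1) (p : ℝ) (y : Bool) :
    betaDensity (a + if y = true then p else 0) (b + if y = false then p else 0) w
      = bern w y ^ p * betaDensity a b w := by
  cases y <;> simp only [bern, betaDensity, if_true, if_false, Bool.false_eq_true, add_zero,
    Bool.true_eq_false]
  · rw [Real.rpow_add (sub_pos.2 h1)]; ring
  · rw [Real.rpow_add h0]; ring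

/-- One step of the potential argument: the mass shrinks at least by the likelihood, to the power
`p`, that the posterior mean assigns to the outcome. -/
theorem betaMass_update_le (ha : 0 ≤ a) (hb : 0 ≤ b) {p : ℝ} (hp0 : 0 ≤ p) (hp1 : p ≤ 1)
    (y : Bool) :
    betaMass (a + if y = true then p else 0) (b + if y = false then p else 0)
      ≤ bern (betaMean a b) y ^ p * betaMass a b := by
  have hc := continuous_betaDensity ha hb
  have hm := bern_pos (betaMean_pos ha hb) (betaMean_lt_one ha hb) y
  set m := bern (betaMean a b) y with hmdef
  have hcb : Continuous fun w : ℝ => bern w y := by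
    cases y <;> simp only [bern, if_true, if_false, Bool.false_eq_true] <;> fun_prop
  have ha' : 0 ≤ a + if y = true then p else 0 := by split_ifs <;> linarith
  have hb' : 0 ≤ b + if y = false then p else 0 := by split_ifs <;> linarith
  have hi := integral_bern_mul_betaDensity ha hb y
  rw [← hmdef] at hi
  calc betaMass (a + if y = true then p else 0) (b + if y = false then p else 0)
      ≤ ∫ w in (0 : ℝ)..1,
          (m ^ p * p / m * (bern w y * betaDensity a b w)
            + m ^ p * (1 - p) * betaDensity a b w) := by
        refine intervalIntegral.integral_mono_on_of_le_Ioo zero_le_one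
          ((continuous_betaDensity ha' hb').intervalIntegrable _ _)
          (Continuous.intervalIntegrable (by fun_prop) _ _) fun w hw => ?_
        rw [betaDensity_update hw.1 hw.2]
        have h := mul_le_mul_of_nonneg_right
          (rpow_le_tangent (bern_pos hw.1 hw.2 y).le hm hp0 hp1)
          (betaDensity_pos (a := a) (b := b) hw.1 hw.2).le
        refine h.trans_eq ?_
        ring
    _ = m ^ p * p / m * (m * betaMass a b) + m ^ p * (1 - p) * betaMass a b := by
        rw [intervalIntegral.integral_add (Continuous.intervalIntegrable (by fun_prop) _ _)
          (Continuous.intervalIntegrable (by fun_prop) _ _),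
          intervalIntegral.integral_const_mul, intervalIntegral.integral_const_mul, hi]
        rfl
    _ = m ^ p * betaMass a b := by field_simp; ring

/-- The mass is comparable to the maximum of the density: on an interval of length `1 / (T + 1)`
around `ρ` the likelihoods are at least `1 - 1 / (T + 1)` times those of `ρ`. -/
theorem neg_log_betaMass_le (ha : 0 ≤ a) (hb : 0 ≤ b) {T ρ : ℝ} (hT : 0 < T) (hab : a + b ≤ T)
    (hρ0 : 0 ≤ ρ) (hρ1 : ρ ≤ 1) (ha0 : a ≠ 0 → ρ ≠ 0) (hb0 : b ≠ 0 → 1 - ρ ≠ 0) :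
    -Real.log (betaMass a b)
      ≤ -(a * Real.log ρ + b * Real.log (1 - ρ)) + (Real.log (T + 1) + 1) := by
  set δ := 1 / (T + 1) with hδ
  have hδ0 : 0 < δ := by positivity
  have hδ1 : δ < 1 := by rw [hδ, div_lt_one (by positivity)]; linarith
  have hd : 0 < 1 - δ := by linarith
  have hc := continuous_betaDensity ha hb
  set M := ρ ^ a * (1 - ρ) ^ b with hM
  have hMpos : 0 < M := by
    refine mul_pos ?_ ?_
    · rcases eq_or_ne a 0 with h | h
      · simp [h]
      · exact Real.rpow_pos_of_pos (hρ0.lt_of_ne' (ha0 h)) _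
    · rcases eq_or_ne b 0 with h | h
      · simp [h]
      · exact Real.rpow_pos_of_pos ((sub_nonneg.2 hρ1).lt_of_ne' (hb0 h)) _
  have hMlog : Real.log M = a * Real.log ρ + b * Real.log (1 - ρ) := by
    have key : ∀ x c : ℝ, 0 ≤ x → (c ≠ 0 → x ≠ 0) →
        x ^ c ≠ 0 ∧ Real.log (x ^ c) = c * Real.log x := by
      intro x c hx h
      rcases eq_or_ne c 0 with hc | hc
      · simp [hc]
      · have := hx.lt_of_ne' (h hc)
        exact ⟨(Real.rpow_pos_of_pos this c).ne', Real.log_rpow this c⟩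
    obtain ⟨h1, h2⟩ := key ρ a hρ0 ha0
    obtain ⟨h3, h4⟩ := key (1 - ρ) b (sub_nonneg.2 hρ1) hb0
    rw [hM, Real.log_mul h1 h3, h2, h4]
  have hlow : δ * ((1 - δ) ^ (a + b) * M) ≤ betaMass a b := by
    have hl0 : 0 ≤ (1 - δ) * ρ := by positivity
    have hl1 : (1 - δ) * ρ + δ ≤ 1 := by nlinarith
    calc δ * ((1 - δ) ^ (a + b) * M)
        = ∫ _ in ((1 - δ) * ρ)..((1 - δ) * ρ + δ), ((1 - δ) ^ (a + b) * M) := by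
          rw [intervalIntegral.integral_const, add_sub_cancel_left, smul_eq_mul]
      _ ≤ ∫ w in ((1 - δ) * ρ)..((1 - δ) * ρ + δ), betaDensity a b w := by
          refine intervalIntegral.integral_mono_on (by linarith)
            (continuous_const.intervalIntegrable _ _) (hc.intervalIntegrable _ _) fun w hw => ?_
          have h1 := Real.rpow_le_rpow hl0 hw.1 ha
          have h2 : ((1 - δ) * (1 - ρ)) ^ b ≤ (1 - w) ^ b :=
            Real.rpow_le_rpow (mul_nonneg hd.le (sub_nonneg.2 hρ1)) (by linarith [hw.2]) hb
          have h3 := mul_le_mul h1 h2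
            (Real.rpow_nonneg (mul_nonneg hd.le (sub_nonneg.2 hρ1)) _)
            (Real.rpow_nonneg (hl0.trans hw.1) _)
          refine le_trans (le_of_eq ?_) h3
          rw [Real.mul_rpow hd.le hρ0, Real.mul_rpow hd.le (sub_nonneg.2 hρ1),
            Real.rpow_add hd, hM]
          ring
      _ ≤ betaMass a b := by
          refine intervalIntegral.integral_mono_interval hl0 (by linarith) hl1 ?_
            (hc.intervalIntegrable _ _)
          refine (MeasureTheory.ae_restrict_iff' measurableSet_Ioc).2 (Filter.Eventually.of_forall
            fun w hw => betaDensity_nonneg hw.1.le hw.2)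
  have hlog := Real.log_le_log (by positivity) hlow
  rw [Real.log_mul hδ0.ne' (by positivity), Real.log_mul (by positivity) hMpos.ne',
    Real.log_rpow hd, hMlog, hδ, one_div, Real.log_inv, ← one_div, ← hδ] at hlog
  -- `-log (1 - δ) ≤ δ / (1 - δ) = 1 / T`
  have hδT : -Real.log (1 - δ) ≤ 1 / T := by
    have h := neg_log_sub_le one_pos hd
    rw [Real.log_one, neg_zero, zero_add, sub_sub_cancel] at h
    refine h.trans_eq ?_
    rw [hδ]; field_simp; rw [add_sub_cancel_right, div_self hT.ne']
  have h0 : 0 ≤ -Real.log (1 - δ) := neg_nonneg.2 (Real.log_nonpos hd.le (by linarith))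
  have hfin : (a + b) * -Real.log (1 - δ) ≤ 1 :=
    calc (a + b) * -Real.log (1 - δ) ≤ T * (1 / T) := by gcongr
      _ = 1 := by field_simp
  linarith

end Beta

section Optimizer

variable {K : ℕ} {F : List Bool → Fin (K + 1) → ℝ} {i : Fin (K + 1)}

/-- The total weight `∑_τ p_{τ,i}` of the rounds of a history whose outcome is `b`. -/
def outcomeWeight (F : List Bool → Fin (K + 1) → ℝ) (i : Fin (K + 1)) (b : Bool) :
    List Bool → ℝ
  | [] => 0
  | y :: h => outcomeWeight F i b h + if y = b then F h i else 0

theorem outcomeWeight_nonneg (hF : ∀ h, 0 ≤ F h i) (b : Bool) (h : List Bool) :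
    0 ≤ outcomeWeight F i b h := by
  induction h with
  | nil => exact le_rfl
  | cons y h ih =>
    have := hF h
    unfold outcomeWeight
    split_ifs <;> linarith

theorem outcomeWeight_history (b : Bool) (y : ℕ → Bool) (T : ℕ) :
    outcomeWeight F i b (history y T)
      = ∑ t ∈ Finset.range T, if y t = b then F (history y t) i else 0 := by
  induction T with
  | zero => rfl
  | succ T ih => rw [Finset.sum_range_succ, ← ih]; rfl

theorem exp_neg_cumLoss {w : ℝ} (h0 : 0 < w) (h1 : w < 1) (h : List Bool) :
    Real.exp (-cumLoss F i w h)
      = betaDensity (outcomeWeight F i true h) (outcomeWeight F i false h) w := by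
  induction h with
  | nil => simp [cumLoss, outcomeWeight, betaDensity]
  | cons y h ih =>
    have hb := bern_pos h0 h1 y
    rw [cumLoss, neg_add, Real.exp_add, ih, logLoss_toReal hb.le]
    have e : Real.exp (-(F h i * -Real.log (bern w y))) = bern w y ^ F h i := by
      rw [Real.rpow_def_of_pos hb]; congr 1; ring
    rw [e, outcomeWeight, outcomeWeight, betaDensity_update h0 h1]
    ring

/-- The densities agree on `(0, 1)`, hence almost everywhere on `[0, 1]`. -/
theorem ewoo_eq_betaMean (h : List Bool) :
    ewoo F i h = betaMean (outcomeWeight F i true h) (outcomeWeight F i false h) := by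
  have hcongr : ∀ f g : ℝ → ℝ, (∀ w, 0 < w → w < 1 → f w = g w) →
      ∫ w in (0 : ℝ)..1, f w = ∫ w in (0 : ℝ)..1, g w := by
    intro f g hfg
    refine intervalIntegral.integral_congr_ae ?_
    have : ∀ᵐ w : ℝ, w ≠ 1 := MeasureTheory.Measure.ae_ne _ _
    filter_upwards [this] with w hw hw'
    rw [Set.uIoc_of_le zero_le_one] at hw'
    exact hfg w hw'.1 (hw'.2.lt_of_ne hw)
  unfold ewoo betaMean betaMass
  congr 1
  · exact hcongr _ _ fun w h0 h1 => by rw [exp_neg_cumLoss h0 h1]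
  · exact hcongr _ _ fun w h0 h1 => exp_neg_cumLoss h0 h1 h

theorem ewoo_pos (hF : ∀ h, 0 ≤ F h i) (h : List Bool) : 0 < ewoo F i h := by
  rw [ewoo_eq_betaMean]
  exact betaMean_pos (outcomeWeight_nonneg hF _ _) (outcomeWeight_nonneg hF _ _)

theorem ewoo_lt_one (hF : ∀ h, 0 ≤ F h i) (h : List Bool) : ewoo F i h < 1 := by
  rw [ewoo_eq_betaMean]
  exact betaMean_lt_one (outcomeWeight_nonneg hF _ _) (outcomeWeight_nonneg hF _ _)

/-- Telescoping of `betaMass_update_le`; the prior has mass `1`. -/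
theorem sum_ewoo_loss_le_neg_log_mass (hF0 : ∀ h, 0 ≤ F h i) (hF1 : ∀ h, F h i ≤ 1)
    (y : ℕ → Bool) (T : ℕ) :
    ∑ t ∈ Finset.range T,
        F (history y t) i * -Real.log (bern (ewoo F i (history y t)) (y t))
      ≤ -Real.log (betaMass (outcomeWeight F i true (history y T))
          (outcomeWeight F i false (history y T))) := by
  induction T with
  | zero => simp [history, outcomeWeight, betaMass, betaDensity]
  | succ T ih =>
    rw [Finset.sum_range_succ]
    set h := history y T with hh
    have ha := outcomeWeight_nonneg hF0 true h
    have hb := outcomeWeight_nonneg hF0 false h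
    have hm := bern_pos (ewoo_pos hF0 h) (ewoo_lt_one hF0 h) (y T)
    have hup := betaMass_update_le ha hb (hF0 h) (hF1 h) (y T)
    rw [← ewoo_eq_betaMean] at hup
    have ha' : 0 ≤ outcomeWeight F i true (y T :: h) := outcomeWeight_nonneg hF0 _ _
    have hb' : 0 ≤ outcomeWeight F i false (y T :: h) := outcomeWeight_nonneg hF0 _ _
    have hlog := Real.log_le_log (betaMass_pos ha' hb') hup
    rw [Real.log_mul (Real.rpow_pos_of_pos hm _).ne' (betaMass_pos ha hb).ne',
      Real.log_rpow hm] at hlog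
    change _ ≤ -Real.log (betaMass (outcomeWeight F i true (y T :: h))
      (outcomeWeight F i false (y T :: h)))
    linarith

/-- The regret of the optimizer against a fixed forecast `ρ` is logarithmic. -/
theorem sum_ewoo_loss_le (hF0 : ∀ h, 0 ≤ F h i) (hF1 : ∀ h, F h i ≤ 1)
    (y : ℕ → Bool) {T : ℕ} (hT : 1 ≤ T) {ρ : ℝ} (hρ0 : 0 ≤ ρ) (hρ1 : ρ ≤ 1)
    (hρ : ∀ t < T, bern ρ (y t) = 0 → F (history y t) i = 0) :
    ∑ t ∈ Finset.range T,
        F (history y t) i * -Real.log (bern (ewoo F i (history y t)) (y t))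
      ≤ ∑ t ∈ Finset.range T, F (history y t) i * -Real.log (bern ρ (y t))
        + (Real.log (T + 1) + 1) := by
  have hT' : (0 : ℝ) < T := by exact_mod_cast hT
  have hne : ∀ b : Bool, outcomeWeight F i b (history y T) ≠ 0 → bern ρ b ≠ 0 := by
    intro b hb h0
    refine hb ?_
    rw [outcomeWeight_history]
    refine Finset.sum_eq_zero fun t ht => ?_
    split_ifs with hy
    · exact hρ t (Finset.mem_range.1 ht) (by rw [hy, h0])
    · rfl
  have hsum : ∑ t ∈ Finset.range T, F (history y t) i * -Real.log (bern ρ (y t))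
      = -(outcomeWeight F i true (history y T) * Real.log ρ
        + outcomeWeight F i false (history y T) * Real.log (1 - ρ)) := by
    rw [outcomeWeight_history, outcomeWeight_history, Finset.sum_mul, Finset.sum_mul,
      ← Finset.sum_add_distrib, ← Finset.sum_neg_distrib]
    refine Finset.sum_congr rfl fun t _ => ?_
    cases y t <;> simp [bern]
  have hab : outcomeWeight F i true (history y T) + outcomeWeight F i false (history y T)
      ≤ T := by
    rw [outcomeWeight_history, outcomeWeight_history, ← Finset.sum_add_distrib]
    calc _ ≤ ∑ _t ∈ Finset.range T, (1 : ℝ) := by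
          refine Finset.sum_le_sum fun t _ => ?_
          have := hF1 (history y t)
          cases y t <;> simpa using this
      _ = T := by simp
  rw [hsum]
  refine (sum_ewoo_loss_le_neg_log_mass hF0 hF1 y T).trans ?_
  exact neg_log_betaMass_le (outcomeWeight_nonneg hF0 _ _) (outcomeWeight_nonneg hF0 _ _) hT' hab
    hρ0 hρ1 (by simpa [bern] using hne true) (by simpa [bern] using hne false)

end Optimizer

/-! ### Existence of the forecaster -/

/-- A column-stochastic matrix `Q` has a stationary distribution: `Q - 1` is singular because the
all-ones vector is a left null vector, and if `Q v = v` then `|v| ≤ Q |v|` entrywise with equal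
entry sums, so that `|v|` is fixed as well. -/
theorem exists_stationary {n : Type*} [Fintype n] [DecidableEq n] [Nonempty n]
    {Q : Matrix n n ℝ} (hQ : Q ∈ Matrix.colStochastic ℝ n) :
    ∃ p ∈ stdSimplex ℝ n, Q.mulVec p = p := by
  have hdet : (Q - 1).det = 0 := by
    refine Matrix.exists_vecMul_eq_zero_iff.1 ⟨1, one_ne_zero, ?_⟩
    rw [Matrix.vecMul_sub, Matrix.one_vecMul_of_mem_colStochastic hQ, Matrix.vecMul_one, sub_self]
  obtain ⟨v, hv0, hv⟩ := Matrix.exists_mulVec_eq_zero_iff.2 hdet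
  rw [Matrix.sub_mulVec, Matrix.one_mulVec, sub_eq_zero] at hv
  have hle : ∀ i, |v i| ≤ Q.mulVec (fun j => |v j|) i := by
    intro i
    conv_lhs => rw [← hv]
    refine (Finset.abs_sum_le_sum_abs _ _).trans_eq ?_
    refine Finset.sum_congr rfl fun j _ => ?_
    rw [abs_mul, abs_of_nonneg (Matrix.nonneg_of_mem_colStochastic hQ)]
  have hfix : Q.mulVec (fun j => |v j|) = fun j => |v j| := by
    have h := (Finset.sum_eq_sum_iff_of_le fun i _ => hle i).1
      (Matrix.sum_mulVec_of_mem_colStochastic hQ).symm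
    exact funext fun i => (h i (Finset.mem_univ i)).symm
  have hS : 0 < ∑ j, |v j| := by
    obtain ⟨i, hi⟩ := Function.ne_iff.1 hv0
    exact Finset.sum_pos' (fun j _ => abs_nonneg _) ⟨i, Finset.mem_univ i, abs_pos.2 hi⟩
  refine ⟨(∑ j, |v j|)⁻¹ • fun j => |v j|, ⟨fun j => ?_, ?_⟩, ?_⟩
  · exact mul_nonneg (inv_nonneg.2 hS.le) (abs_nonneg _)
  · simp only [Pi.smul_apply, smul_eq_mul, ← Finset.mul_sum]
    exact inv_mul_cancel₀ hS.ne'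
  · rw [Matrix.mulVec_smul, hfix]

theorem bmMatrix_mem_colStochastic {K : ℕ} (hK : 1 ≤ K)
    {Q₁ : Matrix (Fin (K + 1)) (Fin (K + 1)) ℝ}
    (hQ₁ : Q₁ ∈ Matrix.colStochastic ℝ (Fin (K + 1))) (F : List Bool → Fin (K + 1) → ℝ)
    (h : List Bool) : bmMatrix Q₁ F h ∈ Matrix.colStochastic ℝ (Fin (K + 1)) := by
  rw [Matrix.mem_colStochastic_iff_sum]
  by_cases hh : h = []
  · simpa [bmMatrix, hh] using Matrix.mem_colStochastic_iff_sum.1 hQ₁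
  · simpa [bmMatrix, hh] using
      (⟨fun j i => rround_nonneg hK _ j, fun i => sum_rround hK _⟩ :
        (∀ j i, 0 ≤ rround K (ewoo F i h) j) ∧ ∀ i, ∑ j, rround K (ewoo F i h) j = 1)

/-- A cumulative loss only depends on the play after proper suffixes of the history. -/
theorem cumLoss_congr {K : ℕ} {F G : List Bool → Fin (K + 1) → ℝ} {h : List Bool}
    (hFG : ∀ h', h'.length < h.length → F h' = G h') (i : Fin (K + 1)) (w : ℝ) :
    cumLoss F i w h = cumLoss G i w h := by
  induction h with
  | nil => rfl
  | cons y h ih =>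
    rw [cumLoss, cumLoss, hFG h (by simp),
      ih fun h' hh => hFG h' (hh.trans (by simp))]

theorem bmMatrix_congr {K : ℕ} (Q₁ : Matrix (Fin (K + 1)) (Fin (K + 1)) ℝ)
    {F G : List Bool → Fin (K + 1) → ℝ} {h : List Bool}
    (hFG : ∀ h', h'.length < h.length → F h' = G h') : bmMatrix Q₁ F h = bmMatrix Q₁ G h := by
  simp only [bmMatrix, ewoo, cumLoss_congr hFG]

/-- The play after the histories of length less than `n` of a forecaster that follows a given
selection `stat` of stationary distributions. -/
def playUpTo {K : ℕ} (Q₁ : Matrix (Fin (K + 1)) (Fin (K + 1)) ℝ)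
    (stat : Matrix (Fin (K + 1)) (Fin (K + 1)) ℝ → Fin (K + 1) → ℝ) :
    ℕ → List Bool → Fin (K + 1) → ℝ
  | 0 => fun _ => 0
  | n + 1 => fun h => if h.length < n then playUpTo Q₁ stat n h
      else stat (bmMatrix Q₁ (playUpTo Q₁ stat n) h)

theorem playUpTo_eq {K : ℕ} (Q₁ : Matrix (Fin (K + 1)) (Fin (K + 1)) ℝ)
    (stat : Matrix (Fin (K + 1)) (Fin (K + 1)) ℝ → Fin (K + 1) → ℝ) (h : List Bool) {n : ℕ}
    (hn : h.length < n) : playUpTo Q₁ stat n h = playUpTo Q₁ stat (h.length + 1) h := by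
  induction n, hn using Nat.le_induction with
  | base => rfl
  | succ n hn ih => rw [← ih, playUpTo]; exact if_pos hn

theorem exists_isBMForecaster {K : ℕ} (hK : 1 ≤ K)
    {Q₁ : Matrix (Fin (K + 1)) (Fin (K + 1)) ℝ}
    (hQ₁ : Q₁ ∈ Matrix.colStochastic ℝ (Fin (K + 1))) :
    ∃ F : List Bool → Fin (K + 1) → ℝ, IsBMForecaster Q₁ F := by
  have hex : ∀ Q : Matrix (Fin (K + 1)) (Fin (K + 1)) ℝ, ∃ p : Fin (K + 1) → ℝ,
      Q ∈ Matrix.colStochastic ℝ (Fin (K + 1)) →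
        p ∈ stdSimplex ℝ (Fin (K + 1)) ∧ Q.mulVec p = p := by
    intro Q
    by_cases hQ : Q ∈ Matrix.colStochastic ℝ (Fin (K + 1))
    · obtain ⟨p, hp⟩ := exists_stationary hQ
      exact ⟨p, fun _ => hp⟩
    · exact ⟨0, fun h => absurd h hQ⟩
  choose stat hstat using hex
  refine ⟨fun h => playUpTo Q₁ stat (h.length + 1) h, fun h => ?_⟩
  have hF : playUpTo Q₁ stat (h.length + 1) h
      = stat (bmMatrix Q₁ (fun h => playUpTo Q₁ stat (h.length + 1) h) h) := by
    rw [playUpTo]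
    refine (if_neg (lt_irrefl _)).trans ?_
    congr 1
    exact bmMatrix_congr Q₁ fun h' hh => playUpTo_eq Q₁ stat h' hh
  have hs := hstat _ (bmMatrix_mem_colStochastic hK hQ₁
    (fun h => playUpTo Q₁ stat (h.length + 1) h) h)
  rwa [← hF] at hs

/-! ### The regret bound -/

section Regret

variable {K : ℕ} {Q₁ : Matrix (Fin (K + 1)) (Fin (K + 1)) ℝ} {F : List Bool → Fin (K + 1) → ℝ}

theorem IsBMForecaster.nonneg (hF : IsBMForecaster Q₁ F) (h : List Bool) (i : Fin (K + 1)) :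
    0 ≤ F h i := (hF h).1.1 i

theorem IsBMForecaster.le_one (hF : IsBMForecaster Q₁ F) (h : List Bool) (i : Fin (K + 1)) :
    F h i ≤ 1 := by
  rw [← (hF h).1.2]
  exact Finset.single_le_sum (fun j _ => (hF h).1.1 j) (Finset.mem_univ i)

theorem forecastPMF_nonneg (hF : ∀ h i, 0 ≤ F h i) (y : ℕ → Bool) (t : ℕ) (p : ℝ) :
    0 ≤ forecastPMF F y t p :=
  Finset.sum_nonneg fun i _ => by split_ifs <;> simp [hF]

theorem le_forecastPMF (hF : ∀ h i, 0 ≤ F h i) (y : ℕ → Bool) (t : ℕ) (i : Fin (K + 1)) :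
    F (history y t) i ≤ forecastPMF F y t (grid K i) := by
  have h := Finset.single_le_sum (s := Finset.univ)
    (f := fun j : Fin (K + 1) => if grid K j = grid K i then F (history y t) j else 0)
    (fun j _ => by split_ifs <;> simp [hF]) (Finset.mem_univ i)
  simpa [forecastPMF] using h

/-- The expectation of a function of the forecast, computed with the indices instead of the
values of the grid points. The grid need not be injective: for `K = 1` both points are `1 / 2`. -/
theorem sum_forecastPMF_mul (y : ℕ → Bool) (t : ℕ) (g : ℝ → ℝ) :
    ∑ p ∈ gridSet K, forecastPMF F y t p * g p
      = ∑ i : Fin (K + 1), F (history y t) i * g (grid K i) := by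
  simp only [forecastPMF, Finset.sum_mul]
  rw [Finset.sum_comm]
  refine Finset.sum_congr rfl fun i _ => ?_
  rw [Finset.sum_eq_single (grid K i)]
  · simp
  · intro p _ hp
    rw [if_neg hp.symm, zero_mul]
  · intro h
    exact absurd (Finset.mem_image_of_mem _ (Finset.mem_univ i)) h

/-- In a round after the first one, stationarity lets the forecasts be drawn in two steps: an
optimizer `i` is chosen by `p_t`, and its output is rounded. -/
theorem forecast_loss_le (hK : 1 ≤ K) (hF : IsBMForecaster Q₁ F) {h : List Bool} (hh : h ≠ [])
    (y : Bool) :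
    ∑ j, F h j * -Real.log (bern (grid K j) y)
      ≤ ∑ i, F h i * -Real.log (bern (ewoo F i h) y) + 8 / (K : ℝ) ^ 2 := by
  have hst : ∀ j, F h j = ∑ i, rround K (ewoo F i h) j * F h i := by
    intro j
    conv_lhs => rw [← (hF h).2]
    simp [Matrix.mulVec, dotProduct, bmMatrix, hh]
  calc ∑ j, F h j * -Real.log (bern (grid K j) y)
      = ∑ j, ∑ i, F h i * (rround K (ewoo F i h) j * -Real.log (bern (grid K j) y)) := by
        refine Finset.sum_congr rfl fun j _ => ?_
        conv_lhs => rw [hst j]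
        rw [Finset.sum_mul]
        exact Finset.sum_congr rfl fun i _ => by ring
    _ = ∑ i, F h i * ∑ j, rround K (ewoo F i h) j * -Real.log (bern (grid K j) y) := by
        rw [Finset.sum_comm]
        simp only [Finset.mul_sum]
    _ ≤ ∑ i, F h i * (-Real.log (bern (ewoo F i h) y) + 8 / (K : ℝ) ^ 2) := by
        refine Finset.sum_le_sum fun i _ => mul_le_mul_of_nonneg_left ?_ (hF.nonneg h i)
        exact rround_loss_le hK (ewoo_pos (fun h => hF.nonneg h i) h)
          (ewoo_lt_one (fun h => hF.nonneg h i) h) y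
    _ = _ := by
        simp only [mul_add, Finset.sum_add_distrib, ← Finset.sum_mul]
        rw [(hF h).1.2, one_mul]

/-- The first round, in which the columns are arbitrary, costs at most the largest loss of a grid
point. -/
theorem sum_forecast_loss_le (hK : 1 ≤ K) (hF : IsBMForecaster Q₁ F) (y : ℕ → Bool) (T : ℕ) :
    ∑ t ∈ Finset.range T, ∑ j, F (history y t) j * -Real.log (bern (grid K j) (y t))
      ≤ ∑ t ∈ Finset.range T,
          ∑ i, F (history y t) i * -Real.log (bern (ewoo F i (history y t)) (y t))
        + T * (8 / (K : ℝ) ^ 2) + 2 * Real.log (2 * K) := by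
  have hK' : (1 : ℝ) ≤ K := by exact_mod_cast hK
  have hlog : 0 ≤ 2 * Real.log (2 * K) := by
    have := Real.log_nonneg (x := 2 * K) (by linarith)
    linarith
  induction T with
  | zero => simpa using hlog
  | succ T ih =>
    rw [Finset.sum_range_succ, Finset.sum_range_succ]
    rcases Nat.eq_zero_or_pos T with rfl | hT
    · have h1 : ∑ j, F (history y 0) j * -Real.log (bern (grid K j) (y 0))
          ≤ 2 * Real.log (2 * K) := by
        calc _ ≤ ∑ j, F (history y 0) j * (2 * Real.log (2 * K)) :=
              Finset.sum_le_sum fun j _ => mul_le_mul_of_nonneg_left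
                (neg_log_bern_grid_le hK (Nat.lt_succ_iff.1 j.2) _) (hF.nonneg _ j)
          _ = _ := by rw [← Finset.sum_mul, (hF _).1.2, one_mul]
      have h2 : 0 ≤ ∑ i, F (history y 0) i * -Real.log (bern (ewoo F i (history y 0)) (y 0)) :=
        Finset.sum_nonneg fun i _ => mul_nonneg (hF.nonneg _ i)
          (neg_log_bern_nonneg (ewoo_pos (fun h => hF.nonneg h i) _).le
            (ewoo_lt_one (fun h => hF.nonneg h i) _).le _)
      have h3 : 0 ≤ 8 / (K : ℝ) ^ 2 := by positivity
      simp only [Finset.range_zero, Finset.sum_empty, zero_add, Nat.cast_one, one_mul]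
      linarith
    · have hne : history y T ≠ [] := by
        cases T with
        | zero => omega
        | succ T => exact List.cons_ne_nil _ _
      have h1 := forecast_loss_le hK hF hne (y T)
      push_cast
      linarith

theorem gridSet_bounds (hK : 1 ≤ K) {p : ℝ} (hp : p ∈ gridSet K) : 0 < p ∧ p < 1 := by
  obtain ⟨i, -, rfl⟩ := Finset.mem_image.1 hp
  exact ⟨grid_pos hK (Nat.lt_succ_iff.1 i.2), grid_lt_one hK (Nat.lt_succ_iff.1 i.2)⟩

/-- The calibration error is at most the rounding error plus the regret of the `K + 1` optimizers,
the `i`-th of which competes with the conditional frequency given `z_i`. -/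
theorem pklCal_le (hK : 1 ≤ K) (hF : IsBMForecaster Q₁ F) (y : ℕ → Bool) {T : ℕ} (hT : 1 ≤ T) :
    pklCal (gridSet K) (forecastPMF F y) y T
      ≤ T * (8 / (K : ℝ) ^ 2) + 2 * Real.log (2 * K) + (K + 1) * (Real.log (T + 1) + 1) := by
  have hP := fun t p => forecastPMF_nonneg hF.nonneg y t p
  set ρ : ℝ → ℝ := fun p => condFreq (forecastPMF F y) y T p with hρ
  have hreg : ∀ i : Fin (K + 1), _ := fun i =>
    sum_ewoo_loss_le (fun h => hF.nonneg h i) (fun h => hF.le_one h i) y hT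
      (condFreq_mem_Icc (y := y) (T := T) (p := grid K i) fun t => hP t _).1
      (condFreq_mem_Icc (y := y) (T := T) (p := grid K i) fun t => hP t _).2
      fun t ht h0 => le_antisymm
        ((le_forecastPMF hF.nonneg y t i).trans_eq
          (eq_zero_of_bern_condFreq_eq_zero (fun t => hP t _) ht h0)) (hF.nonneg _ i)
  have hsum := Finset.sum_le_sum fun i (_ : i ∈ Finset.univ) => hreg i
  rw [Finset.sum_add_distrib, Finset.sum_comm, Finset.sum_const, Finset.card_univ,
    Fintype.card_fin, nsmul_eq_mul] at hsum
  have hloss := sum_forecast_loss_le hK hF y T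
  have hcal : pklCal (gridSet K) (forecastPMF F y) y T
      = ∑ t ∈ Finset.range T, ∑ j, F (history y t) j * -Real.log (bern (grid K j) (y t))
        - ∑ i : Fin (K + 1), ∑ t ∈ Finset.range T,
            F (history y t) i * -Real.log (bern (ρ (grid K i)) (y t)) := by
    rw [pklCal, Finset.sum_congr rfl fun p hp => sum_mul_klBernoulli (fun t => hP t p)
      (gridSet_bounds hK hp).1 (gridSet_bounds hK hp).2, Finset.sum_comm,
      Finset.sum_comm (s := (Finset.univ : Finset (Fin (K + 1)))), ← Finset.sum_sub_distrib]
    refine Finset.sum_congr rfl fun t _ => ?_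
    rw [sum_forecastPMF_mul y t fun p => Real.log (bern (ρ p) (y t)) - Real.log (bern p (y t)),
      ← Finset.sum_sub_distrib]
    exact Finset.sum_congr rfl fun i _ => by ring
  rw [hcal]
  push_cast at hsum
  linarith

end Regret

/-! ### Tuning the grid size -/

theorem half_le_and_le_two_mul {x : ℝ} (hx : 1 ≤ x) {K : ℕ} (hK : |(K : ℝ) - x| < 1) :
    1 ≤ K ∧ x / 2 ≤ K ∧ (K : ℝ) ≤ 2 * x := by
  rw [abs_lt] at hK
  have h0 : (0 : ℝ) < K := by linarith
  have h1 : 1 ≤ K := by exact_mod_cast h0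
  have h1' : (1 : ℝ) ≤ K := by exact_mod_cast h1
  refine ⟨h1, ?_, by linarith⟩
  rcases le_total x 2 with h | h <;> linarith

/-- With `K ≈ (T / log T) ^ (1 / 3)` the rounding error `T / K²` and the regret `K log T` of the
optimizers are of the same order. -/
theorem tuned_bound {T : ℕ} (hT : 2 ≤ T) {K : ℕ}
    (hK : |(K : ℝ) - ((T : ℝ) / Real.log T) ^ (1 / 3 : ℝ)| < 1) :
    1 ≤ K ∧ T * (8 / (K : ℝ) ^ 2) + 2 * Real.log (2 * K) + (K + 1) * (Real.log (T + 1) + 1)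
      ≤ 64 * ((T : ℝ) ^ (1 / 3 : ℝ) * Real.log T ^ (2 / 3 : ℝ)) := by
  have hT' : (2 : ℝ) ≤ T := by exact_mod_cast hT
  have hT0 : (0 : ℝ) < T := by linarith
  set L := Real.log T with hL
  have hL2 : 1 / 2 ≤ L := by
    have := Real.log_le_log two_pos hT'
    linarith [Real.log_two_gt_d9]
  have hL0 : 0 < L := by linarith
  have hLT : L ≤ T := (Real.log_le_sub_one_of_pos hT0).trans (by linarith)
  set x := ((T : ℝ) / L) ^ (1 / 3 : ℝ) with hx
  have hx1 : 1 ≤ x := Real.one_le_rpow ((one_le_div hL0).2 hLT) (by norm_num)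
  have hx0 : 0 < x := by linarith
  obtain ⟨hK1, hKl, hKu⟩ := half_le_and_le_two_mul hx1 hK
  refine ⟨hK1, ?_⟩
  have hK1' : (1 : ℝ) ≤ K := by exact_mod_cast hK1
  -- The target rate is `x L`, and `T = x³ L`.
  have hx3 : x ^ 3 * L = T := by
    rw [hx, ← Real.rpow_natCast, ← Real.rpow_mul (by positivity)]
    norm_num
    field_simp
  have hrate : (T : ℝ) ^ (1 / 3 : ℝ) * L ^ (2 / 3 : ℝ) = x * L := by
    have e : L ^ (2 / 3 : ℝ) = L / L ^ (1 / 3 : ℝ) := by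
      rw [show (2 / 3 : ℝ) = 1 - 1 / 3 by norm_num, Real.rpow_sub hL0, Real.rpow_one]
    rw [hx, Real.div_rpow hT0.le hL0.le, e]
    ring
  rw [hrate]
  have h1 : T * (8 / (K : ℝ) ^ 2) ≤ 32 * (x * L) := by
    have hK2 : x ^ 2 ≤ 4 * (K : ℝ) ^ 2 := by nlinarith
    rw [mul_div_assoc', div_le_iff₀ (by positivity), ← hx3]
    nlinarith [mul_le_mul_of_nonneg_left hK2 (mul_pos hx0 hL0).le]
  have h2 : 2 * Real.log (2 * K) ≤ 16 * (x * L) := by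
    have := Real.log_le_sub_one_of_pos (x := 2 * (K : ℝ)) (by linarith)
    nlinarith
  have h3 : Real.log (T + 1) + 1 ≤ 4 * L := by
    have : Real.log (T + 1) ≤ Real.log ((T : ℝ) ^ 2) :=
      Real.log_le_log (by linarith) (by nlinarith)
    rw [Real.log_pow] at this
    push_cast at this
    linarith
  have hlog : 0 ≤ Real.log (T + 1) := Real.log_nonneg (by linarith)
  have h4 : (K + 1) * (Real.log (T + 1) + 1) ≤ 16 * (x * L) := by
    calc (K + 1) * (Real.log (T + 1) + 1) ≤ (4 * x) * (4 * L) := by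
          gcongr
          linarith
      _ = 16 * (x * L) := by ring
  linarith

end

theorem mainTheorem2 :
    (∀ K : ℕ, 1 ≤ K → ∀ Q₁ : Matrix (Fin (K + 1)) (Fin (K + 1)) ℝ,
      Q₁ ∈ Matrix.colStochastic ℝ (Fin (K + 1)) →
      ∃ F : List Bool → Fin (K + 1) → ℝ, IsBMForecaster Q₁ F) ∧
    ∃ C : ℝ, 0 < C ∧ ∀ T : ℕ, 2 ≤ T →
      ∀ K : ℕ, |(K : ℝ) - ((T : ℝ) / Real.log T) ^ (1 / 3 : ℝ)| < 1 →
      ∀ Q₁ : Matrix (Fin (K + 1)) (Fin (K + 1)) ℝ,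
      Q₁ ∈ Matrix.colStochastic ℝ (Fin (K + 1)) →
      ∀ F : List Bool → Fin (K + 1) → ℝ, IsBMForecaster Q₁ F →
      ∀ y : ℕ → Bool,
        pklCal (gridSet K) (forecastPMF F y) y T
            ≤ C * ((T : ℝ) ^ (1 / 3 : ℝ) * Real.log T ^ (2 / 3 : ℝ)) ∧
        logPSReg (gridSet K) (forecastPMF F y) y T
            ≤ ((C * ((T : ℝ) ^ (1 / 3 : ℝ) * Real.log T ^ (2 / 3 : ℝ)) : ℝ) : EReal) := by
  refine ⟨fun K hK Q₁ hQ₁ => exists_isBMForecaster hK hQ₁, 64, by norm_num, ?_⟩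
  intro T hT K hKT Q₁ _ F hF y
  obtain ⟨hK, hbound⟩ := tuned_bound hT hKT
  have hcal := (pklCal_le hK hF y (by omega)).trans hbound
  refine ⟨hcal, ?_⟩
  exact (logPSReg_le_pklCal (forecastPMF_nonneg hF.nonneg y) fun p hp => gridSet_bounds hK hp).trans
    (EReal.coe_le_coe_iff.2 hcal)
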